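/- \textbf{Setting.} Let $\mathcal{Q}$ be a local quantum field theory, given by its spacetime dimension $d$ and a set $\mathcal{R}=\mathcal{R}^{[0]}\amalg\mathcal{R}^{[1]}$ of residues (vertex types and edge types) with weights $\omega:\mathcal{R}\to\mathbb{N}_0$. Let $\mathscr{G}$ be the set of isomorphism classes of one-particle irreducible (in particular connected) Feynman graphs with at least one internal edge and at least one external leg that are generated by $\mathcal{R}$. The superficial degree of divergence is $\omega(\Gamma)=d\,b_1(\Gamma)+\sum_v\omega(v)-\sum_e\omega(e)$, and $\Gamma$ is divergent if $\omega(\Gamma)\ge 0$. Let $\mathscr{D}(\Gamma)$ be the set of all subgraphs $\gamma=\coprod_m\gamma_m$ of $\Gamma$ whose connected components $\gamma_m$ are divergent graphs of $\mathscr{G}$ (including $\gamma=\emptyset$). The quotient $\Gamma/\gamma$ is obtained by shrinking each component of $\gamma$ to a vertex (to an edge, if its residue is an edge type), with $\Gamma/\emptyset=\Gamma$ and $\Gamma/\Gamma=\mathbb{I}$. Let $\mathcal{H}$ be the free commutative $\mathbb{Q}$-algebra generated by $\mathscr{G}$; its product is the disjoint union, and its unit $\mathbb{I}$ is the empty graph.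 Its coproduct $\Delta$ and its antipode $S$ are the algebra homomorphisms given on $\Gamma\in\mathscr{G}$ by $$\Delta(\Gamma)=\Gamma\otimes\mathbb{I}+\mathbb{I}\otimes\Gamma+\sum_{\gamma}\gamma\otimes\Gamma/\gamma,\qquad S(\Gamma)=-\Gamma-\sum_{\gamma}S(\gamma)\,\Gamma/\gamma,$$ where $\gamma$ runs over the elements of $\mathscr{D}(\Gamma)$ with $\emptyset\ne\gamma\ne\Gamma$. The coidentity $\hat{\mathbb{I}}$ is the algebra homomorphism that vanishes on $\mathscr{G}$. Either the residue of every divergent graph in $\mathscr{G}$ is in $\mathcal{R}$, or the construction is modified in one of the following ways. (a) $\mathscr{G}$ is replaced by the set of those graphs that contain no divergent subgraph whose residue is not in $\mathcal{R}$, and graphs outside this set are zero. (b) Components with residue not in $\mathcal{R}$ are not admitted in $\mathscr{D}(\Gamma)$. (c) If for every residue of a divergent graph that is not in $\mathcal{R}$ there are trees built from $\mathcal{R}$ with this residue, and only finitely many up to isomorphism, then instead of shrinking a component with such a residue one replaces it by the sum of all these trees, where summands that are not in $\mathscr{G}$ are zero. (The option to enlarge $\mathcal{R}$ by the missing residues is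 the unmodified construction for the enlarged theory.) \textbf{Proposition (condition for Hopf ideals).} Let $\emptyset\neq\mathscr{S}$ be a set of graphs among the generators of $\mathcal{H}$, and let $\mathfrak{i}_{\mathscr{S}}$ be the ideal of $\mathcal{H}$ generated by $\mathscr{S}$. Then $\mathfrak{i}_{\mathscr{S}}$ is a Hopf ideal, i.e. 1. $\Delta(\mathfrak{i}_{\mathscr{S}})\subseteq\mathcal{H}\otimes\mathfrak{i}_{\mathscr{S}}+\mathfrak{i}_{\mathscr{S}}\otimes\mathcal{H}$, 2. $\hat{\mathbb{I}}(\mathfrak{i}_{\mathscr{S}})=0$, 3. $S(\mathfrak{i}_{\mathscr{S}})\subseteq\mathfrak{i}_{\mathscr{S}}$, if and only if for all $\Gamma\in\mathscr{S}$ and all $\gamma\in\mathscr{D}(\Gamma)$ at least one connected component of $\gamma$ is in $\mathscr{S}$ or $\Gamma/\gamma$ is in $\mathscr{S}$. (In cases (a) and (c), where $\Gamma/\gamma$ can be zero or a sum of graphs, the latter means that $\Gamma/\gamma$ is in the $\mathbb{Q}$-linear span of $\mathscr{S}$; for a single graph this is membership in $\mathscr{S}$.) -/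

import Mathlib

open scoped TensorProduct

noncomputable section

/-- Graphs made of half-edges. Every half-edge `h` sits at the vertex `vert h` and carries a field
label. `pair` matches half-edges: if `pair h ≠ h`, then `h` and `pair h` are the two halves of an
internal edge; if `pair h = h`, then `h` is an external leg. -/
structure PreGraph (F : Type) where
  V : Type
  H : Type
  finV : Finite V
  finH : Finite H
  vert : H → V
  field : H → F
  pair : H → H

namespace PreGraph

variable {F : Type}

instance (G : PreGraph F) : Finite G.V := G.finV
instance (G : PreGraph F) : Finite G.H := G.finH

/-- Isomorphisms of graphs; the external legs carry no labels besides their fields. -/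
structure Iso (G G' : PreGraph F) where
  onV : G.V ≃ G'.V
  onH : G.H ≃ G'.H
  vert_eq : ∀ h, G'.vert (onH h) = onV (G.vert h)
  field_eq : ∀ h, G'.field (onH h) = G.field h
  pair_eq : ∀ h, G'.pair (onH h) = onH (G.pair h)

def Iso.refl (G : PreGraph F) : Iso G G :=
  ⟨Equiv.refl _, Equiv.refl _, fun _ => rfl, fun _ => rfl, fun _ => rfl⟩

def Iso.symm {G G' : PreGraph F} (i : Iso G G') : Iso G' G where
  onV := i.onV.symm
  onH := i.onH.symm
  vert_eq h := by
    rw [Equiv.eq_symm_apply, ← i.vert_eq, Equiv.apply_symm_apply]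
  field_eq h := by
    rw [← i.field_eq, Equiv.apply_symm_apply]
  pair_eq h := by
    rw [Equiv.eq_symm_apply, ← i.pair_eq, Equiv.apply_symm_apply]

def Iso.trans {G G' G'' : PreGraph F} (i : Iso G G') (j : Iso G' G'') : Iso G G'' where
  onV := i.onV.trans j.onV
  onH := i.onH.trans j.onH
  vert_eq h := by simp [j.vert_eq, i.vert_eq]
  field_eq h := by simp [j.field_eq, i.field_eq]
  pair_eq h := by simp [j.pair_eq, i.pair_eq]

/-- The half-edges that belong to internal edges. -/
def internal (G : PreGraph F) : Set G.H := {h | G.pair h ≠ h}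

/-- The external legs. -/
def external (G : PreGraph F) : Set G.H := {h | G.pair h = h}

/-- The multiset of the fields carried by a set of half-edges. -/
def fields (G : PreGraph F) (A : Set G.H) : Multiset F :=
  (Set.toFinite A).toFinset.val.map G.field

/-- The type of a vertex: the multiset of the fields of its half-edges. -/
def vertexType (G : PreGraph F) (v : G.V) : Multiset F := G.fields {h | G.vert h = v}

/-- The residue: what is left when all internal edges are shrunk to one point, that is, the multiset
of the fields of the external legs. -/
def residue (G : PreGraph F) : Multiset F := G.fields G.external

/-- The internal edges, as unordered pairs of half-edges. -/
def edgeSet (G : PreGraph F) : Set (Sym2 G.H) := (fun h => s(h, G.pair h)) '' G.internal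

/-- The type of an edge: the multiset of the fields of its two halves. -/
def edgeType (G : PreGraph F) (e : Sym2 G.H) : Multiset F :=
  Sym2.lift ⟨fun h k => ({G.field h, G.field k} : Multiset F), fun _ _ => Multiset.pair_comm _ _⟩ e

/-- Two vertices are joined by a path in the edges formed by the half-edges of `E`. -/
def joinedSetoid (G : PreGraph F) (E : Set G.H) : Setoid G.V :=
  Relation.EqvGen.setoid (fun v w => ∃ h ∈ E, G.vert h = v ∧ G.vert (G.pair h) = w)

/-- The connected components of the graph with all vertices and with the edges in `E`. -/
abbrev Comp (G : PreGraph F) (E : Set G.H) : Type := Quotient (G.joinedSetoid E)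

/-- The first Betti number, by Euler's formula: edges minus vertices plus connected components. -/
def firstBetti (G : PreGraph F) : ℤ :=
  (Nat.card G.edgeSet : ℤ) - Nat.card G.V + Nat.card (G.Comp G.internal)

def IsConnected (G : PreGraph F) : Prop :=
  Nonempty G.V ∧ ∀ v w, (G.joinedSetoid G.internal).r v w

/-- One-particle irreducible: connected, at least one internal edge, and still connected after
the removal of any one internal edge. -/
def IsOnePI (G : PreGraph F) : Prop :=
  G.IsConnected ∧ G.internal.Nonempty ∧
    ∀ h ∈ G.internal, ∀ v w, (G.joinedSetoid (G.internal \ {h, G.pair h})).r v w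

/-- A subgraph without isolated vertices: a set of internal edges, with the vertices they touch.
All other half-edges at these vertices are external legs of the subgraph. -/
@[ext]
structure Subgraph (G : PreGraph F) where
  edges : Set G.H
  pair_mem_iff : ∀ h, G.pair h ∈ edges ↔ h ∈ edges
  edges_subset : edges ⊆ G.internal

namespace Subgraph

variable {G : PreGraph F}

instance : Finite G.Subgraph :=
  Finite.of_injective (fun γ : G.Subgraph => γ.edges) (fun _ _ h => Subgraph.ext h)

/-- The connected components of a subgraph (those components that contain an edge of it). -/
abbrev Parts (γ : G.Subgraph) : Type :=
  {c : G.Comp γ.edges // ∃ h ∈ γ.edges, Quotient.mk _ (G.vert h) = c}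

open Classical in
/-- A connected component of a subgraph, as a graph of its own. -/
def part (γ : G.Subgraph) (m : γ.Parts) : PreGraph F where
  V := {v : G.V // (Quotient.mk _ v : G.Comp γ.edges) = m.1}
  H := {h : G.H // (Quotient.mk _ (G.vert h) : G.Comp γ.edges) = m.1}
  finV := inferInstance
  finH := inferInstance
  vert h := ⟨G.vert h.1, h.2⟩
  field h := G.field h.1
  pair h :=
    if hh : h.1 ∈ γ.edges then
      ⟨G.pair h.1, 
        (Quotient.sound (Setoid.symm' _ (Relation.EqvGen.rel _ _ ⟨h.1, hh, rfl, rfl⟩))).trans h.2⟩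
    else h

end Subgraph

/-- Shrink every connected component of `γ` to one vertex. -/
def shrink (G : PreGraph F) (γ : G.Subgraph) : PreGraph F where
  V := G.Comp γ.edges
  H := {h : G.H // h ∉ γ.edges}
  finV := inferInstance
  finH := inferInstance
  vert h := Quotient.mk _ (G.vert h.1)
  field h := G.field h.1
  pair h := ⟨G.pair h.1, fun hh => h.2 ((γ.pair_mem_iff h.1).1 hh)⟩

open Classical in
/-- Another half-edge at the vertex of `h` (unique if this vertex is two-valent). -/
def other (G : PreGraph F) (h : G.H) : G.H :=
  if hh : ∃ k, k ≠ h ∧ G.vert k = G.vert h then hh.choose else h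

open Classical in
/-- One step along a line: a half-edge at a vertex of `B` is followed through this vertex. -/
def follow (G : PreGraph F) (B : Set G.V) (h : G.H) : G.H :=
  if G.vert h ∈ B then G.pair (G.other h) else h

open Classical in
/-- Delete the two-valent vertices in `B`: the two lines that meet there become one line. The half
`h` of an edge is matched with the first half-edge outside of `B` on the line that begins
at `pair h`. (The last branch does not occur: the line returns at the latest to `h`.) -/
def smooth (G : PreGraph F) (B : Set G.V) : PreGraph F where
  V := {v : G.V // v ∉ B}
  H := {h : G.H // G.vert h ∉ B}
  finV := inferInstance
  finH := inferInstance
  vert h := ⟨G.vert h.1, h.2⟩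
  field h := G.field h.1
  pair h :=
    if hh : G.vert ((G.follow B)^[Nat.card G.H] (G.pair h.1)) ∉ B then
      ⟨(G.follow B)^[Nat.card G.H] (G.pair h.1), hh⟩
    else h

end PreGraph

/-- A local quantum field theory, given by its weighted residue set. `conj` is charge conjugation of
field labels (the identity on neutral or unoriented fields): an edge joins a half-edge with label `a`
to one with label `conj a`. Residues are multisets of field labels. -/
structure LocalQFT where
  Field : Type
  conj : Field → Field
  conj_conj : ∀ a, conj (conj a) = a
  dim : ℕ
  vertexResidues : Set (Multiset Field)
  edgeResidues : Set (Multiset Field)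
  edge_form : ∀ r ∈ edgeResidues, ∃ a, r = {a, conj a}
  vertex_ne_zero : (0 : Multiset Field) ∉ vertexResidues
  disjoint : Disjoint vertexResidues edgeResidues
  /-- Only the values on the residues matter. -/
  weight : Multiset Field → ℕ

namespace LocalQFT

def residues (Q : LocalQFT) : Set (Multiset Q.Field) := Q.vertexResidues ∪ Q.edgeResidues

/-- All vertices and all internal edges have a type in the residue set. -/
def IsTyped (Q : LocalQFT) (G : PreGraph Q.Field) : Prop :=
  Function.Involutive G.pair ∧ (∀ v, G.vertexType v ∈ Q.vertexResidues) ∧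
    ∀ e ∈ G.edgeSet, G.edgeType e ∈ Q.edgeResidues

/-- The one-particle irreducible Feynman graphs generated by the residue set. Vacuum graphs, which
have neither a vertex nor an edge as residue, are excluded. -/
def IsFeynman (Q : LocalQFT) (G : PreGraph Q.Field) : Prop :=
  Q.IsTyped G ∧ G.IsOnePI ∧ G.external.Nonempty

/-- The superficial degree of divergence. -/
def sdd (Q : LocalQFT) (G : PreGraph Q.Field) : ℤ :=
  Q.dim * G.firstBetti + ∑ᶠ v : G.V, (Q.weight (G.vertexType v) : ℤ)
    - ∑ᶠ e ∈ G.edgeSet, (Q.weight (G.edgeType e) : ℤ)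

/-- The ways to associate a renormalization Hopf algebra to a theory: the plain construction, and
three modifications for theories with divergent graphs whose residue is not in the residue set. -/
inductive Scheme
  /-- No modification. -/
  | standard
  /-- Discard all graphs that contain a divergent subgraph with residue outside the residue set. -/
  | restrictGraphs
  /-- Discard, as subgraphs, the divergent graphs with residue outside the residue set. -/
  | restrictSubgraphs
  /-- Instead of shrinking a divergent graph with residue outside the residue set,
  replace it by the sum of all trees with this residue. -/
  | insertTrees

/-- The graphs that generate the Hopf algebra. -/
def IsGenerator (Q : LocalQFT) (s : Scheme) (G : PreGraph Q.Field) : Prop :=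
  Q.IsFeynman G ∧
    (s = .restrictGraphs → ∀ γ : G.Subgraph,
      (∀ m, Q.IsFeynman (γ.part m) ∧ 0 ≤ Q.sdd (γ.part m)) →
        ∀ m, (γ.part m).residue ∈ Q.residues)

instance graphSetoid (Q : LocalQFT) (s : Scheme) :
    Setoid {G : PreGraph Q.Field // Q.IsGenerator s G} where
  r G G' := Nonempty (PreGraph.Iso G.1 G'.1)
  iseqv := ⟨fun _ => ⟨.refl _⟩, fun ⟨i⟩ => ⟨i.symm⟩, fun ⟨i⟩ ⟨j⟩ => ⟨i.trans j⟩⟩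

/-- Isomorphism classes of generating graphs. -/
def Graph (Q : LocalQFT) (s : Scheme) : Type 1 := Quotient (Q.graphSetoid s)

/-- A graph that represents an isomorphism class. -/
def Graph.rep {Q : LocalQFT} {s : Scheme} (c : Q.Graph s) : PreGraph Q.Field :=
  (Quotient.out c : {G : PreGraph Q.Field // Q.IsGenerator s G}).1

def mkGraph (Q : LocalQFT) (s : Scheme) (G : PreGraph Q.Field) (h : Q.IsGenerator s G) :
    Q.Graph s :=
  Quotient.mk (Q.graphSetoid s) ⟨G, h⟩

/-- The algebra generated by the graphs, with the disjoint union as product: its basis consists of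
all disjoint unions of generating graphs, up to isomorphism, and `1` is the empty graph. -/
abbrev HopfAlg (Q : LocalQFT) (s : Scheme) : Type 1 := MvPolynomial (Q.Graph s) ℚ

open Classical in
/-- A connected graph as an element of the algebra; graphs that are not generators are zero. -/
def toHopfAlg (Q : LocalQFT) (s : Scheme) (G : PreGraph Q.Field) : Q.HopfAlg s :=
  if h : Q.IsGenerator s G then MvPolynomial.X (Q.mkGraph s G h) else 0

/-- The set of superficially divergent subgraphs: every connected component is a divergent graph
(the empty subgraph is included). -/
structure DivSubgraph (Q : LocalQFT) (s : Scheme) (G : PreGraph Q.Field)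
    extends PreGraph.Subgraph G where
  isGenerator : ∀ m, Q.IsGenerator s (toSubgraph.part m)
  divergent : ∀ m, 0 ≤ Q.sdd (toSubgraph.part m)
  residue_mem : s = .restrictSubgraphs → ∀ m, (toSubgraph.part m).residue ∈ Q.residues

/-- The isomorphism class of a connected component of a divergent subgraph. -/
def DivSubgraph.partClass {Q : LocalQFT} {s : Scheme} {G : PreGraph Q.Field}
    (γ : Q.DivSubgraph s G) (m : γ.toSubgraph.Parts) : Q.Graph s :=
  Q.mkGraph s _ (γ.isGenerator m)

/-- The proper and non-empty divergent subgraphs. -/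
abbrev ProperDivSubgraph (Q : LocalQFT) (s : Scheme) (G : PreGraph Q.Field) : Type :=
  {γ : Q.DivSubgraph s G // γ.edges.Nonempty ∧ γ.edges ≠ G.internal}

instance (Q : LocalQFT) (s : Scheme) (G : PreGraph Q.Field) : Finite (Q.DivSubgraph s G) :=
  Finite.of_injective (fun γ => γ.toSubgraph) (by
    rintro ⟨γ, _⟩ ⟨δ, _⟩ h
    cases h
    rfl)

instance (Q : LocalQFT) (s : Scheme) (G : PreGraph Q.Field) : Fintype (Q.ProperDivSubgraph s G) :=
  Fintype.ofFinite _

instance {F : Type} {G : PreGraph F} (γ : G.Subgraph) : Fintype γ.Parts := Fintype.ofFinite _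

/-- Shrink the connected components of a subgraph to vertices, or to edges where their residue
is an edge residue. -/
def contract (Q : LocalQFT) (G : PreGraph Q.Field) (γ : G.Subgraph) : PreGraph Q.Field :=
  (G.shrink γ).smooth
    {c | (∃ m : γ.Parts, m.1 = c) ∧ (G.shrink γ).vertexType c ∈ Q.edgeResidues}

/-- Tree graphs whose external legs are labelled by `L`, where the leg `l` carries the field `f l`. -/
structure LegTree (Q : LocalQFT) (L : Type) (f : L → Q.Field) where
  graph : PreGraph Q.Field
  isTyped : Q.IsTyped graph
  isConnected : graph.IsConnected
  acyclic : graph.firstBetti = 0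
  leg : L → graph.H
  leg_injective : Function.Injective leg
  range_leg : Set.range leg = graph.external
  field_leg : ∀ l, graph.field (leg l) = f l

instance treeSetoid (Q : LocalQFT) (L : Type) (f : L → Q.Field) : Setoid (Q.LegTree L f) where
  r T T' := ∃ i : PreGraph.Iso T.graph T'.graph, ∀ l, i.onH (T.leg l) = T'.leg l
  iseqv := by
    refine ⟨fun T => ⟨.refl _, fun _ => rfl⟩, ?_, ?_⟩
    · rintro T T' ⟨i, hi⟩
      exact ⟨i.symm, fun l => by rw [← hi l]; exact i.onH.symm_apply_apply _⟩
    · rintro T T' T'' ⟨i, hi⟩ ⟨j, hj⟩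
      exact ⟨i.trans j, fun l => by rw [← hj l, ← hi l]; rfl⟩

/-- Trees up to isomorphisms that fix the external legs. -/
def TreeClass (Q : LocalQFT) (L : Type) (f : L → Q.Field) : Type 1 :=
  Quotient (Q.treeSetoid L f)

def TreeClass.rep {Q : LocalQFT} {L : Type} {f : L → Q.Field} (t : Q.TreeClass L f) :
    Q.LegTree L f :=
  (Quotient.out t : Q.LegTree L f)

open Classical in
/-- Replace every vertex `v` by a tree `T v`, whose legs are the half-edges at `v`. -/
def expand (Q : LocalQFT) (G : PreGraph Q.Field)
    (T : ∀ v : G.V, Q.LegTree {h : G.H // G.vert h = v} (fun h => G.field h.1)) :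
    PreGraph Q.Field where
  V := Σ v, (T v).graph.V
  H := Σ v, (T v).graph.H
  finV := inferInstance
  finH := inferInstance
  vert x := ⟨x.1, (T x.1).graph.vert x.2⟩
  field x := (T x.1).graph.field x.2
  pair x :=
    if hx : ∃ l, (T x.1).leg l = x.2 then
      ⟨G.vert (G.pair hx.choose.1), (T _).leg ⟨G.pair hx.choose.1, rfl⟩⟩
    else ⟨x.1, (T x.1).graph.pair x.2⟩

/-- The choices of one tree for every vertex: a vertex with a type in the residue set stays as it is
(it is replaced by the tree with one vertex), for any other vertex all trees are admitted. -/
def treeChoices (Q : LocalQFT) (G : PreGraph Q.Field) :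
    Set (∀ v : G.V, Q.TreeClass {h : G.H // G.vert h = v} (fun h => G.field h.1)) :=
  {t | ∀ v, G.vertexType v ∈ Q.vertexResidues → Nat.card (t v).rep.graph.V = 1}

open Classical in
/-- The quotient `Γ/γ`, as an element of the algebra. -/
def quotient (Q : LocalQFT) (s : Scheme) (G : PreGraph Q.Field) (γ : G.Subgraph) : Q.HopfAlg s :=
  if γ.edges = ∅ then Q.toHopfAlg s G
  else if γ.edges = G.internal then 1
  else match s with
    | .insertTrees =>
        ∑ᶠ t ∈ Q.treeChoices (Q.contract G γ),
          Q.toHopfAlg .insertTrees (Q.expand (Q.contract G γ) (fun v => (t v).rep))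
    | s => Q.toHopfAlg s (Q.contract G γ)

/-- When a scheme can be applied. -/
def Applicable (Q : LocalQFT) : Scheme → Prop
  | .standard => ∀ G, Q.IsFeynman G → 0 ≤ Q.sdd G → G.residue ∈ Q.residues
  | .restrictGraphs => True
  | .restrictSubgraphs => True
  | .insertTrees => ∀ G, Q.IsFeynman G → 0 ≤ Q.sdd G → G.residue ∉ Q.residues →
      Nonempty (Q.TreeClass G.external (fun h => G.field h.1)) ∧
        Finite (Q.TreeClass G.external (fun h => G.field h.1))

/-- A divergent subgraph as an element of the algebra: the product of its components. -/
def DivSubgraph.toHopfAlg {Q : LocalQFT} {s : Scheme} {G : PreGraph Q.Field}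
    (γ : Q.DivSubgraph s G) : Q.HopfAlg s :=
  ∏ m : γ.toSubgraph.Parts, MvPolynomial.X (γ.partClass m)

/-- The coproduct: on a graph `Γ` it is the sum of `Γ ⊗ 1`, of `1 ⊗ Γ`, and of `γ ⊗ Γ/γ` for the
proper non-empty divergent subgraphs `γ`. -/
def coproduct (Q : LocalQFT) (s : Scheme) : Q.HopfAlg s →ₐ[ℚ] Q.HopfAlg s ⊗[ℚ] Q.HopfAlg s :=
  MvPolynomial.aeval fun c =>
    MvPolynomial.X c ⊗ₜ[ℚ] 1 + 1 ⊗ₜ[ℚ] MvPolynomial.X c +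
      ∑ γ : Q.ProperDivSubgraph s c.rep,
        γ.1.toHopfAlg ⊗ₜ[ℚ] Q.quotient s c.rep γ.1.toSubgraph

/-- The coidentity: the coefficient of the empty graph. -/
def coidentity (Q : LocalQFT) (s : Scheme) : Q.HopfAlg s →ₐ[ℚ] ℚ :=
  MvPolynomial.aeval fun _ => 0

/-- The number of half-edges in internal edges, on which the antipode recurses. -/
def Graph.size {Q : LocalQFT} {s : Scheme} (c : Q.Graph s) : ℕ := Nat.card c.rep.internal

theorem card_internal_of_iso {F : Type} {G G' : PreGraph F} (i : PreGraph.Iso G G') :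
    Nat.card G.internal = Nat.card G'.internal := by
  refine Nat.card_congr (i.onH.subtypeEquiv fun h => ?_)
  change G.pair h ≠ h ↔ G'.pair (i.onH h) ≠ i.onH h
  rw [i.pair_eq, i.onH.injective.ne_iff]

theorem card_internal_part {F : Type} {G : PreGraph F} (γ : G.Subgraph)
    (hγ : γ.edges ≠ G.internal) (m : γ.Parts) :
    Nat.card (γ.part m).internal < Nat.card G.internal := by
  classical
  have key : ∀ h : (γ.part m).internal, h.1.1 ∈ γ.edges := by
    rintro ⟨h, hh⟩
    by_contra hn
    exact hh (dif_neg hn)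
  have hinj : Function.Injective (fun h : (γ.part m).internal => (⟨h.1.1, key h⟩ : γ.edges)) := by
    rintro ⟨⟨a, _⟩, _⟩ ⟨⟨b, _⟩, _⟩ hab
    have hab' : a = b := congrArg Subtype.val hab
    subst hab'
    rfl
  calc Nat.card (γ.part m).internal ≤ Nat.card γ.edges := Nat.card_le_card_of_injective _ hinj
    _ < Nat.card G.internal := by
        rw [Nat.card_coe_set_eq, Nat.card_coe_set_eq]
        exact Set.ncard_lt_ncard (lt_of_le_of_ne γ.edges_subset hγ) (Set.toFinite _)

theorem size_partClass {Q : LocalQFT} {s : Scheme} (c : Q.Graph s)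
    (γ : Q.ProperDivSubgraph s c.rep) (m : γ.1.toSubgraph.Parts) :
    (γ.1.partClass m).size < c.size := by
  obtain ⟨i⟩ : Nonempty (PreGraph.Iso (γ.1.partClass m).rep (γ.1.toSubgraph.part m)) :=
    Quotient.exact (Quotient.out_eq (γ.1.partClass m))
  rw [Graph.size, card_internal_of_iso i]
  exact card_internal_part _ γ.2.2 m

/-- The antipode of a graph: `S(Γ) = - Γ - ∑ S(γ) Γ/γ`, where `γ` runs over the proper non-empty
divergent subgraphs, and `S(γ)` is the product over the components of `γ`. -/
def antipodeGraph (Q : LocalQFT) (s : Scheme) (c : Q.Graph s) : Q.HopfAlg s :=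
  - MvPolynomial.X c - ∑ γ : Q.ProperDivSubgraph s c.rep,
    (∏ m : γ.1.toSubgraph.Parts, Q.antipodeGraph s (γ.1.partClass m)) *
      Q.quotient s c.rep γ.1.toSubgraph
termination_by c.size
decreasing_by exact size_partClass c γ m

/-- The antipode, extended multiplicatively. -/
def antipode (Q : LocalQFT) (s : Scheme) : Q.HopfAlg s →ₐ[ℚ] Q.HopfAlg s :=
  MvPolynomial.aeval (Q.antipodeGraph s)

/-- Hopf ideals: `Δ(i) ⊆ i ⊗ H + H ⊗ i`, the coidentity vanishes on `i`, and `S(i) ⊆ i`. -/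
def IsHopfIdeal (Q : LocalQFT) (s : Scheme) (i : Ideal (Q.HopfAlg s)) : Prop :=
  (∀ x ∈ i, Q.coproduct s x ∈
    LinearMap.range (TensorProduct.map (i.restrictScalars ℚ).subtype
      (LinearMap.id : Q.HopfAlg s →ₗ[ℚ] Q.HopfAlg s)) ⊔
    LinearMap.range (TensorProduct.map
      (LinearMap.id : Q.HopfAlg s →ₗ[ℚ] Q.HopfAlg s) (i.restrictScalars ℚ).subtype)) ∧
  (∀ x ∈ i, Q.coidentity s x = 0) ∧
  ∀ x ∈ i, Q.antipode s x ∈ i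

end LocalQFT

end

/-! The coproduct condition alone forces the condition on subgraphs, by positivity. Let χ be the
character `avoid S`, with value 0 on `S` and 1 on all other generators. It kills the ideal, so χ ⊗ χ
kills I ⊗ H + H ⊗ I. Evaluated on Δ(Γ) with Γ in `S`, this leaves ∑ χ(γ) χ(Γ/γ) = 0 over the proper
non-empty γ (`sum_avoid_mul_avoid_eq_zero`). Each χ(γ) is a product of zeros and ones, and each Γ/γ
is zero or a sum of generators, so no summand is negative and all of them vanish. If χ(γ) = 0, some
component of γ is in `S`; if χ(Γ/γ) = 0, all generators in Γ/γ are in `S` (`Faithful.quotient`). The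
two extreme subgraphs satisfy the condition for any `S`: Γ is the only component of the full
subgraph, and Γ/∅ = Γ.

Conversely, the maps are multiplicative, so generators suffice. Every summand of Δ(Γ) or S(Γ) then
has a factor in the ideal; for the antipode this is an induction on the number of internal
half-edges (`antipodeGraph_mem`). -/

namespace PreGraph

open Classical in
/-- A connected component of the subgraph of all internal edges is the whole connected graph. -/
def isoPartOfEdgesEqInternal {F : Type} {G : PreGraph F} (hG : G.IsConnected) (γ : G.Subgraph)
    (hγ : γ.edges = G.internal) (m : γ.Parts) : Iso (γ.part m) G :=
  have key : ∀ v : G.V, (Quotient.mk _ v : G.Comp γ.edges) = m.1 := fun v => by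
    obtain ⟨w, hw⟩ := Quotient.exists_rep m.1
    rw [← hw]
    refine Quotient.sound ?_
    have h := hG.2 v w
    rwa [← hγ] at h
  { onV := Equiv.subtypeUnivEquiv key
    onH := Equiv.subtypeUnivEquiv fun h => key (G.vert h)
    vert_eq := fun _ => rfl
    field_eq := fun _ => rfl
    pair_eq := fun h => by
      change G.pair h.1 = ((γ.part m).pair h).1
      by_cases hh : h.1 ∈ γ.edges
      · simp [Subgraph.part, hh]
      -- A half-edge outside `γ.edges` is an external leg of `G`, so both pairings fix it.
      · have hp : G.pair h.1 = h.1 := by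
          by_contra hne
          exact hh (hγ.ge hne)
        simp [Subgraph.part, hh, hp] }

end PreGraph

/-! ### Representatives of classes, and the full subgraph -/

namespace LocalQFT

variable {Q : LocalQFT} {s : Scheme}

theorem Graph.isGenerator_rep (c : Q.Graph s) : Q.IsGenerator s c.rep :=
  (Quotient.out c : {G : PreGraph Q.Field // Q.IsGenerator s G}).2

theorem Graph.mkGraph_rep (c : Q.Graph s) : Q.mkGraph s c.rep c.isGenerator_rep = c :=
  Quotient.out_eq c

theorem Graph.toHopfAlg_rep (c : Q.Graph s) :
    Q.toHopfAlg s c.rep = MvPolynomial.X c := by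
  rw [toHopfAlg, dif_pos c.isGenerator_rep, c.mkGraph_rep]

theorem DivSubgraph.partClass_of_edges_eq_internal (c : Q.Graph s) (γ : Q.DivSubgraph s c.rep)
    (hγ : γ.edges = c.rep.internal) (m : γ.toSubgraph.Parts) : γ.partClass m = c := by
  conv_rhs => rw [← c.mkGraph_rep]
  exact Quotient.sound
    ⟨PreGraph.isoPartOfEdgesEqInternal c.isGenerator_rep.1.2.1.1 γ.toSubgraph hγ m⟩

/-- One-particle irreducibility includes the existence of an internal edge, so the full subgraph has
a component at all. -/
theorem DivSubgraph.exists_partClass_eq (c : Q.Graph s) (γ : Q.DivSubgraph s c.rep)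
    (hγ : γ.edges = c.rep.internal) : ∃ m, γ.partClass m = c := by
  obtain ⟨h, hh⟩ := c.isGenerator_rep.1.2.1.2.1
  exact ⟨⟨Quotient.mk _ (c.rep.vert h), h, hγ ▸ hh, rfl⟩,
    γ.partClass_of_edges_eq_internal c hγ _⟩

/-! ### The character that counts the monomials without factors in `S` -/

open Classical in
/-- The character of the algebra that is `0` on the graphs in `S` and `1` on all other graphs. -/
noncomputable def avoid (S : Set (Q.Graph s)) : Q.HopfAlg s →ₐ[ℚ] ℚ :=
  MvPolynomial.aeval fun c => if c ∈ S then 0 else 1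

open Classical in
theorem avoid_X (S : Set (Q.Graph s)) (c : Q.Graph s) :
    avoid S (MvPolynomial.X c) = if c ∈ S then 0 else 1 := by
  simp [avoid]

theorem avoid_eq_zero_of_mem (S : Set (Q.Graph s)) {x : Q.HopfAlg s}
    (hx : x ∈ Ideal.span (MvPolynomial.X '' S)) : avoid S x = 0 := by
  have h : Ideal.span (MvPolynomial.X '' S) ≤ RingHom.ker (avoid S) := by
    rw [Ideal.span_le]
    rintro _ ⟨c, hc, rfl⟩
    simp [RingHom.mem_ker, avoid_X, hc]
  exact h hx

/-- The elements on which `avoid S` is nonnegative, and zero only within the span of `S`. -/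
def Faithful (S : Set (Q.Graph s)) (x : Q.HopfAlg s) : Prop :=
  0 ≤ avoid S x ∧ (avoid S x = 0 →
    x ∈ Submodule.span ℚ ((MvPolynomial.X : Q.Graph s → Q.HopfAlg s) '' S))

theorem Faithful.zero (S : Set (Q.Graph s)) : Faithful S 0 :=
  ⟨by simp, fun _ => zero_mem _⟩

/-- Nonnegative values cannot cancel: if the sum has value zero, so do both summands. This is what
handles the sums of trees. -/
theorem Faithful.add {S : Set (Q.Graph s)} {x y : Q.HopfAlg s} (hx : Faithful S x)
    (hy : Faithful S y) : Faithful S (x + y) := by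
  refine ⟨by rw [map_add]; exact add_nonneg hx.1 hy.1, fun h => ?_⟩
  rw [map_add, add_eq_zero_iff_of_nonneg hx.1 hy.1] at h
  exact add_mem (hx.2 h.1) (hy.2 h.2)

theorem Faithful.toHopfAlg (S : Set (Q.Graph s)) (G : PreGraph Q.Field) :
    Faithful S (Q.toHopfAlg s G) := by
  by_cases h : Q.IsGenerator s G
  · rw [LocalQFT.toHopfAlg, dif_pos h]
    by_cases hc : Q.mkGraph s G h ∈ S
    · exact ⟨by simp [avoid_X, hc], fun _ => Submodule.subset_span ⟨_, hc, rfl⟩⟩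
    · exact ⟨by simp [avoid_X, hc], fun h0 => by simp [avoid_X, hc] at h0⟩
  · rw [LocalQFT.toHopfAlg, dif_neg h]
    exact .zero S

/-- In every scheme the quotient by such a `γ` is a generator, zero, or a sum of these without
signs. -/
theorem Faithful.quotient (S : Set (Q.Graph s)) (G : PreGraph Q.Field) (γ : G.Subgraph)
    (hγ : γ.edges ≠ G.internal) : Faithful S (Q.quotient s G γ) := by
  unfold LocalQFT.quotient
  rw [if_neg hγ]
  split_ifs
  · exact .toHopfAlg S G
  · split
    -- The base case 0 also covers the default value of `finsum` on an infinite support.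
    · exact finsum_mem_induction (Faithful S) (.zero S) (fun _ _ hx hy => hx.add hy)
        fun t _ => Faithful.toHopfAlg S _
    · exact .toHopfAlg S _

open Classical in
theorem avoid_toHopfAlg (S : Set (Q.Graph s)) {G : PreGraph Q.Field} (γ : Q.DivSubgraph s G) :
    avoid S γ.toHopfAlg = ∏ m, if γ.partClass m ∈ S then 0 else 1 := by
  simp only [DivSubgraph.toHopfAlg, map_prod, avoid_X]

theorem avoid_toHopfAlg_nonneg (S : Set (Q.Graph s)) {G : PreGraph Q.Field}
    (γ : Q.DivSubgraph s G) : 0 ≤ avoid S γ.toHopfAlg := by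
  classical
  rw [avoid_toHopfAlg]
  exact Finset.prod_nonneg fun m _ => by split_ifs <;> simp

theorem exists_partClass_mem_of_avoid_eq_zero (S : Set (Q.Graph s)) {G : PreGraph Q.Field}
    (γ : Q.DivSubgraph s G) (h : avoid S γ.toHopfAlg = 0) : ∃ m, γ.partClass m ∈ S := by
  classical
  rw [avoid_toHopfAlg, Finset.prod_eq_zero_iff] at h
  obtain ⟨m, -, hm⟩ := h
  exact ⟨m, by by_contra hn; simp [hn] at hm⟩

/-! ### From Hopf ideals to the condition on subgraphs -/

theorem sum_avoid_mul_avoid_eq_zero {S : Set (Q.Graph s)}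
    (hS : Q.IsHopfIdeal s (Ideal.span (MvPolynomial.X '' S))) {c : Q.Graph s} (hc : c ∈ S) :
    ∑ γ : Q.ProperDivSubgraph s c.rep,
      avoid S γ.1.toHopfAlg * avoid S (Q.quotient s c.rep γ.1.toSubgraph) = 0 := by
  have hX : MvPolynomial.X c ∈ Ideal.span ((MvPolynomial.X : _ → Q.HopfAlg s) '' S) :=
    Ideal.subset_span ⟨c, hc, rfl⟩
  -- This is χ ⊗ χ followed by multiplication in ℚ; it vanishes on both summands I ⊗ H and H ⊗ I.
  let f : Q.HopfAlg s ⊗[ℚ] Q.HopfAlg s →ₐ[ℚ] ℚ :=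
    Algebra.TensorProduct.lift (avoid S) (avoid S) fun _ _ => Commute.all _ _
  have hf : ∀ x y, f (x ⊗ₜ y) = avoid S x * avoid S y :=
    fun x y => Algebra.TensorProduct.lift_tmul _ _ _ x y
  have h : f (Q.coproduct s (MvPolynomial.X c)) = 0 := by
    obtain ⟨_, ⟨a, rfl⟩, _, ⟨b, rfl⟩, hab⟩ := Submodule.mem_sup.1 (hS.1 _ hX)
    rw [← hab, map_add]
    have ha : f (TensorProduct.map (Submodule.subtype _) LinearMap.id a) = 0 := by
      clear hab
      induction a with
      | zero => simp
      | add x y hx hy => rw [map_add, map_add, hx, hy, add_zero]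
      | tmul x y =>
        rw [TensorProduct.map_tmul, hf, Submodule.subtype_apply, avoid_eq_zero_of_mem S x.2,
          zero_mul]
    have hb : f (TensorProduct.map LinearMap.id (Submodule.subtype _) b) = 0 := by
      clear hab
      induction b with
      | zero => simp
      | add x y hx hy => rw [map_add, map_add, hx, hy, add_zero]
      | tmul x y =>
        rw [TensorProduct.map_tmul, hf, Submodule.subtype_apply, avoid_eq_zero_of_mem S y.2,
          mul_zero]
    rw [ha, hb, add_zero]
  -- The terms Γ ⊗ 1 and 1 ⊗ Γ contribute nothing, since the character is zero on `c`.
  simpa [coproduct, hf, avoid_X, hc] using h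

theorem quotient_mem_span_of_isHopfIdeal {S : Set (Q.Graph s)}
    (hS : Q.IsHopfIdeal s (Ideal.span (MvPolynomial.X '' S))) {c : Q.Graph s} (hc : c ∈ S)
    (γ : Q.DivSubgraph s c.rep) :
    (∃ m, γ.partClass m ∈ S) ∨ Q.quotient s c.rep γ.toSubgraph ∈
      Submodule.span ℚ ((MvPolynomial.X : Q.Graph s → Q.HopfAlg s) '' S) := by
  by_cases hfull : γ.edges = c.rep.internal
  · obtain ⟨m, hm⟩ := γ.exists_partClass_eq c hfull
    exact .inl ⟨m, by rwa [hm]⟩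
  by_cases hempty : γ.edges = ∅
  · right
    unfold quotient
    rw [if_pos hempty, c.toHopfAlg_rep]
    exact Submodule.subset_span ⟨c, hc, rfl⟩
  -- A vanishing sum of nonnegative terms vanishes termwise, which isolates the given `γ`.
  have h := (Finset.sum_eq_zero_iff_of_nonneg fun δ _ =>
    mul_nonneg (avoid_toHopfAlg_nonneg S δ.1) (Faithful.quotient S _ _ δ.2.2).1).1
    (sum_avoid_mul_avoid_eq_zero hS hc)
    ⟨γ, Set.nonempty_iff_ne_empty.2 hempty, hfull⟩ (Finset.mem_univ _)
  exact (mul_eq_zero.1 h).imp (exists_partClass_mem_of_avoid_eq_zero S γ)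
    (Faithful.quotient S _ _ hfull).2

/-! ### Ideals generated by graphs -/

theorem span_le_ideal_span (S : Set (Q.Graph s)) {x : Q.HopfAlg s}
    (hx : x ∈ Submodule.span ℚ ((MvPolynomial.X : Q.Graph s → Q.HopfAlg s) '' S)) :
    x ∈ Ideal.span ((MvPolynomial.X : Q.Graph s → Q.HopfAlg s) '' S) :=
  Submodule.span_le_restrictScalars ℚ (Q.HopfAlg s) _ hx

theorem DivSubgraph.toHopfAlg_mem {S : Set (Q.Graph s)} {G : PreGraph Q.Field}
    (γ : Q.DivSubgraph s G) (h : ∃ m, γ.partClass m ∈ S) :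
    γ.toHopfAlg ∈ Ideal.span ((MvPolynomial.X : Q.Graph s → Q.HopfAlg s) '' S) := by
  obtain ⟨m, hm⟩ := h
  exact Ideal.mem_of_dvd _ (Finset.dvd_prod_of_mem _ (Finset.mem_univ m))
    (Ideal.subset_span ⟨_, hm, rfl⟩)

/-- Writing I ⊗ H + H ⊗ I as a sum of two extended ideals makes it an ideal of the tensor product.
Its preimage under the algebra homomorphism Δ is again an ideal, so only generators have to be
checked. -/
theorem coproduct_mem {S : Set (Q.Graph s)}
    (h : ∀ Γ ∈ S, ∀ γ : Q.DivSubgraph s Γ.rep, (∃ m, γ.partClass m ∈ S) ∨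
      Q.quotient s Γ.rep γ.toSubgraph ∈
        Submodule.span ℚ ((MvPolynomial.X : Q.Graph s → Q.HopfAlg s) '' S))
    {x : Q.HopfAlg s} (hx : x ∈ Ideal.span (MvPolynomial.X '' S)) :
    Q.coproduct s x ∈
      (Ideal.span (MvPolynomial.X '' S)).map
        (Algebra.TensorProduct.includeLeft : Q.HopfAlg s →ₐ[ℚ] Q.HopfAlg s ⊗[ℚ] Q.HopfAlg s) ⊔
      (Ideal.span (MvPolynomial.X '' S)).map
        (Algebra.TensorProduct.includeRight : Q.HopfAlg s →ₐ[ℚ] Q.HopfAlg s ⊗[ℚ] Q.HopfAlg s) := by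
  set I : Ideal (Q.HopfAlg s) := Ideal.span (MvPolynomial.X '' S)
  set J := I.map
    (Algebra.TensorProduct.includeLeft : Q.HopfAlg s →ₐ[ℚ] Q.HopfAlg s ⊗[ℚ] Q.HopfAlg s) ⊔
    I.map (Algebra.TensorProduct.includeRight : Q.HopfAlg s →ₐ[ℚ] Q.HopfAlg s ⊗[ℚ] Q.HopfAlg s)
  have left : ∀ a ∈ I, ∀ b, a ⊗ₜ[ℚ] b ∈ J := fun a ha b => by
    have h1 : a ⊗ₜ[ℚ] (1 : Q.HopfAlg s) ∈ J :=
      Ideal.mem_sup_left (Ideal.mem_map_of_mem Algebra.TensorProduct.includeLeft ha)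
    simpa using J.mul_mem_right (1 ⊗ₜ[ℚ] b) h1
  have right : ∀ a, ∀ b ∈ I, a ⊗ₜ[ℚ] b ∈ J := fun a b hb => by
    have h1 : (1 : Q.HopfAlg s) ⊗ₜ[ℚ] b ∈ J :=
      Ideal.mem_sup_right (Ideal.mem_map_of_mem Algebra.TensorProduct.includeRight hb)
    simpa using J.mul_mem_left (a ⊗ₜ[ℚ] 1) h1
  suffices hle : I ≤ J.comap (Q.coproduct s) from hle hx
  rw [Ideal.span_le]
  rintro _ ⟨c, hc, rfl⟩
  have hX : MvPolynomial.X c ∈ I := Ideal.subset_span ⟨c, hc, rfl⟩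
  rw [SetLike.mem_coe, Ideal.mem_comap, coproduct, MvPolynomial.aeval_X]
  refine add_mem (add_mem (left _ hX _) (right _ _ hX)) (sum_mem fun γ _ => ?_)
  rcases h c hc γ.1 with hm | hq
  · exact left _ (γ.1.toHopfAlg_mem hm) _
  · exact right _ _ (span_le_ideal_span S hq)

/-- A component of a proper subgraph has fewer internal half-edges than the graph. If it lies in
`S`, the induction hypothesis puts its antipode, a factor of S(γ), into the ideal; otherwise the
factor Γ/γ is already there. -/
theorem antipodeGraph_mem {S : Set (Q.Graph s)}
    (h : ∀ Γ ∈ S, ∀ γ : Q.DivSubgraph s Γ.rep, (∃ m, γ.partClass m ∈ S) ∨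
      Q.quotient s Γ.rep γ.toSubgraph ∈
        Submodule.span ℚ ((MvPolynomial.X : Q.Graph s → Q.HopfAlg s) '' S))
    (c : Q.Graph s) (hc : c ∈ S) :
    Q.antipodeGraph s c ∈ Ideal.span ((MvPolynomial.X : Q.Graph s → Q.HopfAlg s) '' S) := by
  rw [antipodeGraph]
  refine sub_mem (neg_mem (Ideal.subset_span ⟨c, hc, rfl⟩)) (sum_mem fun γ _ => ?_)
  rcases h c hc γ.1 with ⟨m, hm⟩ | hq
  · exact Ideal.mul_mem_right _ _ (Ideal.mem_of_dvd _
      (Finset.dvd_prod_of_mem _ (Finset.mem_univ m)) (antipodeGraph_mem h _ hm))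
  · exact Ideal.mul_mem_left _ _ (span_le_ideal_span S hq)
termination_by c.size
decreasing_by exact size_partClass c γ m

theorem isHopfIdeal_of_quotient_mem_span {S : Set (Q.Graph s)}
    (h : ∀ Γ ∈ S, ∀ γ : Q.DivSubgraph s Γ.rep, (∃ m, γ.partClass m ∈ S) ∨
      Q.quotient s Γ.rep γ.toSubgraph ∈
        Submodule.span ℚ ((MvPolynomial.X : Q.Graph s → Q.HopfAlg s) '' S)) :
    Q.IsHopfIdeal s (Ideal.span (MvPolynomial.X '' S)) := by
  refine ⟨fun x hx => ?_, fun x hx => ?_, fun x hx => ?_⟩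
  · have hJ := coproduct_mem h hx
    obtain ⟨a, ha, b, hb, hab⟩ := Submodule.mem_sup.1 hJ
    rw [← hab]
    refine Submodule.add_mem_sup ?_ ?_
    -- Over ℚ the extended ideal is the image of I ⊗ H, the form that `IsHopfIdeal` asks for.
    · rw [← Submodule.restrictScalars_mem ℚ, Ideal.map_includeLeft_eq] at ha
      exact ha
    · rw [← Submodule.restrictScalars_mem ℚ, Ideal.map_includeRight_eq] at hb
      exact hb
  · have hle : Ideal.span (MvPolynomial.X '' S) ≤ RingHom.ker (Q.coidentity s) := by
      rw [Ideal.span_le]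
      rintro _ ⟨c, -, rfl⟩
      simp [RingHom.mem_ker, coidentity]
    exact hle hx
  · have hle : Ideal.span (MvPolynomial.X '' S) ≤
        (Ideal.span (MvPolynomial.X '' S)).comap (Q.antipode s) := by
      rw [Ideal.span_le]
      rintro _ ⟨c, hc, rfl⟩
      rw [SetLike.mem_coe, Ideal.mem_comap, antipode, MvPolynomial.aeval_X]
      exact antipodeGraph_mem h c hc
    exact hle hx

end LocalQFT

theorem mainTheorem2 (Q : LocalQFT) (s : LocalQFT.Scheme) (hs : Q.Applicable s)
    (S : Set (Q.Graph s)) (hS : S.Nonempty) :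
    Q.IsHopfIdeal s (Ideal.span (MvPolynomial.X '' S)) ↔
      ∀ Γ ∈ S, ∀ γ : Q.DivSubgraph s Γ.rep,
        (∃ m, γ.partClass m ∈ S) ∨
          Q.quotient s Γ.rep γ.toSubgraph ∈
            Submodule.span ℚ ((MvPolynomial.X : Q.Graph s → Q.HopfAlg s) '' S) :=
  ⟨fun h _ hΓ γ => LocalQFT.quotient_mem_span_of_isHopfIdeal h hΓ γ,
    LocalQFT.isHopfIdeal_of_quotient_mem_span⟩
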